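/- Let $\mathcal G$ be the set of functions $f:[0,1]\to[0,\infty)$ such that $f(0)=f(1)=0$, the function $t\mapsto f(t)+t$ is nondecreasing on $[0,1]$, and the function $t\mapsto f(t)/t$ is nonincreasing on $(0,1]$. A reflected maxmin (RMM) copula is a function of the form $$C_{f,g}(u,v)=\max\{0,\,uv-f(u)g(v)\},\qquad u,v\in[0,1],$$ with $f,g\in\mathcal G$. A copula $C$ is called fully singular if the Borel probability measure $\mu_C$ on $[0,1]^2$ that it induces, i.e. the one with $\mu_C([0,u]\times[0,v])=C(u,v)$ for all $u,v\in[0,1]$, is singular with respect to the Lebesgue measure on $[0,1]^2$. Then the only fully singular RMM copula is the Fréchet–Hoeffding lower bound $W(u,v)=\max\{0,u+v-1\}$: a function $C:[0,1]^2\to\mathbb R$ is a fully singular RMM copula if and only if $C=W$. -/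

import Mathlib

open MeasureTheory

/-- A generator of a reflected maxmin copula: a function `f : [0,1] → [0,∞)` with
`f 0 = f 1 = 0` such that `t ↦ f t + t` is nondecreasing on `[0,1]` and
`t ↦ f t / t` is nonincreasing on `(0,1]`. -/
structure IsRMMGenerator (f : unitInterval → ℝ) : Prop where
  nonneg : ∀ t, 0 ≤ f t
  map_zero : f 0 = 0
  map_one : f 1 = 0
  monotone_hat : Monotone fun t : unitInterval => f t + (t : ℝ)
  antitoneOn_star : AntitoneOn (fun t : unitInterval => f t / (t : ℝ)) (Set.Ioc 0 1)

/-- The function `C_{f,g}(u,v) = max {0, u v - f(u) g(v)}` on the unit square. -/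
def rmmCopula (f g : unitInterval → ℝ) (u v : unitInterval) : ℝ :=
  max 0 ((u : ℝ) * (v : ℝ) - f u * g v)

/-- Reflected maxmin (RMM) copulas: the functions `C_{f,g}` for generators `f` and `g`. -/
def IsRMMCopula (C : unitInterval → unitInterval → ℝ) : Prop :=
  ∃ f g : unitInterval → ℝ, IsRMMGenerator f ∧ IsRMMGenerator g ∧ C = rmmCopula f g

/-- `μ` is the Borel probability measure on `[0,1]²` induced by `C`, that is, `C` is its
distribution function: `μ ([0,u] × [0,v]) = C(u,v)`. -/
structure IsInducedMeasure (μ : Measure (unitInterval × unitInterval))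
    (C : unitInterval → unitInterval → ℝ) : Prop where
  isProbabilityMeasure : IsProbabilityMeasure μ
  real_rect : ∀ u v : unitInterval, μ.real (Set.Iic u ×ˢ Set.Iic v) = C u v

/-- There is at most one measure induced by `C`. -/
theorem IsInducedMeasure.unique {μ ν : Measure (unitInterval × unitInterval)}
    {C : unitInterval → unitInterval → ℝ}
    (hμ : IsInducedMeasure μ C) (hν : IsInducedMeasure ν C) : μ = ν := by
  have := hμ.isProbabilityMeasure
  have := hν.isProbabilityMeasure
  have hspan : IsCountablySpanning (Set.range (Set.Iic : unitInterval → Set unitInterval)) :=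
    ⟨fun _ => Set.Iic 1, fun _ => ⟨1, rfl⟩, by
      rw [Set.iUnion_const]; exact Set.eq_univ_of_forall fun x => x.2.2⟩
  have hgen : (inferInstance : MeasurableSpace (unitInterval × unitInterval)) =
      MeasurableSpace.generateFrom
        (Set.image2 (· ×ˢ ·) (Set.range (Set.Iic : unitInterval → Set unitInterval))
          (Set.range (Set.Iic : unitInterval → Set unitInterval))) := by
    have h := borel_eq_generateFrom_Iic unitInterval
    rw [← BorelSpace.measurable_eq (α := unitInterval)] at h
    exact (generateFrom_eq_prod h.symm h.symm hspan hspan).symm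
  refine ext_of_generate_finite _ hgen (isPiSystem_Iic.prod isPiSystem_Iic) ?_ (by simp)
  rintro _ ⟨_, ⟨u, rfl⟩, _, ⟨v, rfl⟩, rfl⟩
  have h := (hμ.real_rect u v).trans (hν.real_rect u v).symm
  exact (measureReal_eq_measureReal_iff (measure_ne_top _ _) (measure_ne_top _ _)).mp h

/-- A copula is fully singular when the probability measure on `[0,1]²` that it induces is
singular with respect to the Lebesgue measure (its singular part has mass `1`). -/
def IsFullySingular (C : unitInterval → unitInterval → ℝ) : Prop :=
  ∃ μ : Measure (unitInterval × unitInterval), IsInducedMeasure μ C ∧ μ ⟂ₘ volume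

/-- The Fréchet–Hoeffding lower bound `W(u,v) = max {0, u + v - 1}`. -/
def frechetHoeffdingLower (u v : unitInterval) : ℝ :=
  max 0 ((u : ℝ) + (v : ℝ) - 1)

/-! Write F(u) = f(u) + u and G(v) = g(v) + v, both nondecreasing. Where the maximum is uv -
f(u)g(v), expanding gives C + FG = Fv + uG. Away from 0, F and G are Lipschitz, so their Stieltjes
measures have densities, and this identity makes the induced measure absolutely continuous there
(`IsInducedMeasure.quadrant_eq_zero`). A singular measure therefore gives such a region mass zero.
Since f(t) ≤ 1 - t and g(t) ≤ 1 - t, every quadrant with corner (a, 1 - a) is such a region. Its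
mass is a(1 - a) - f(a)g(1 - a), which vanishes only if both bounds are equalities. Then uv - (1 -
u)(1 - v) = u + v - 1. Conversely, W is the law of (t, 1 - t) for uniform t, carried by the null
antidiagonal. -/

open Set in
/-- Two finite measures on the unit square that agree on all lower-left rectangles are equal. -/
theorem unitInterval.ext_of_Iic_prod_Iic {μ ν : Measure (unitInterval × unitInterval)}
    [IsFiniteMeasure μ] (h : ∀ u v : unitInterval, μ (Iic u ×ˢ Iic v) = ν (Iic u ×ˢ Iic v)) :
    μ = ν := by
  have hspan : IsCountablySpanning (range (Iic : unitInterval → Set unitInterval)) :=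
    ⟨fun _ => Iic 1, fun _ => ⟨1, rfl⟩, by
      rw [iUnion_const]; exact eq_univ_of_forall fun x => x.2.2⟩
  have hgen : (inferInstance : MeasurableSpace (unitInterval × unitInterval)) =
      MeasurableSpace.generateFrom
        (image2 (· ×ˢ ·) (range (Iic : unitInterval → Set unitInterval))
          (range (Iic : unitInterval → Set unitInterval))) := by
    have h := borel_eq_generateFrom_Iic unitInterval
    rw [← BorelSpace.measurable_eq (α := unitInterval)] at h
    exact (generateFrom_eq_prod h.symm h.symm hspan hspan).symm
  have huniv : (Iic 1 : Set unitInterval) ×ˢ (Iic 1 : Set unitInterval) = univ :=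
    eq_univ_of_forall fun x => ⟨x.1.2.2, x.2.2.2⟩
  refine ext_of_generate_finite _ hgen (isPiSystem_Iic.prod isPiSystem_Iic) ?_ ?_
  · rintro _ ⟨_, ⟨u, rfl⟩, _, ⟨v, rfl⟩, rfl⟩
    exact h u v
  · simpa only [huniv] using h 1 1

open Set in
/-- Finite measures on the unit square that agree on the rectangles `(a,x] × (b,y]` agree on
the quadrant `(a,1] × (b,1]`. -/
theorem unitInterval.restrict_quadrant_eq {μ ν : Measure (unitInterval × unitInterval)}
    [IsFiniteMeasure μ] {a b : unitInterval}
    (h : ∀ x y : unitInterval, a ≤ x → b ≤ y → μ (Ioc a x ×ˢ Ioc b y) = ν (Ioc a x ×ˢ Ioc b y)) :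
    μ.restrict (Ioi a ×ˢ Ioi b) = ν.restrict (Ioi a ×ˢ Ioi b) := by
  refine unitInterval.ext_of_Iic_prod_Iic fun u v => ?_
  have hm : MeasurableSet (Iic u ×ˢ Iic v) := measurableSet_Iic.prod measurableSet_Iic
  have hI : ∀ c w : unitInterval, Iic w ∩ Ioi c = Ioc c (w ⊔ c) := by
    intro c w
    ext t
    simp only [mem_inter_iff, mem_Iic, mem_Ioi, mem_Ioc, le_sup_iff]
    constructor
    · rintro ⟨h1, h2⟩
      exact ⟨h2, Or.inl h1⟩
    · rintro ⟨h1, h2 | h2⟩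
      · exact ⟨h2, h1⟩
      · exact absurd h2 (not_le.mpr h1)
  rw [Measure.restrict_apply hm, Measure.restrict_apply hm, prod_inter_prod, hI, hI]
  exact h _ _ le_sup_right le_sup_right

/-! ### Regularity of generators -/

namespace IsRMMGenerator

variable {f g : unitInterval → ℝ}

theorem le_one_sub (hf : IsRMMGenerator f) (t : unitInterval) : f t ≤ 1 - t := by
  have h := hf.monotone_hat (unitInterval.le_one' (t := t))
  simp only [hf.map_one, Set.Icc.coe_one] at h
  linarith

theorem map_mul_le_map_mul (hf : IsRMMGenerator f) {s t : unitInterval} (hs : 0 < s) (hst : s ≤ t) :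
    f t * s ≤ f s * t := by
  have h := hf.antitoneOn_star ⟨hs, s.2.2⟩ ⟨hs.trans_le hst, t.2.2⟩ hst
  have hs' : (0 : ℝ) < s := hs
  have ht' : (0 : ℝ) < t := hs.trans_le hst
  exact (div_le_div_iff₀ ht' hs').mp h

/-- Monotonicity of f(t)/t bounds the slope of f from s by f(s)/s ≤ f(a)/a. With `monotone_hat`,
this gives the Lipschitz property on [a,1]. -/
theorem hat_sub_le (hf : IsRMMGenerator f) {a s t : unitInterval} (ha : 0 < a) (has : a ≤ s)
    (hst : s ≤ t) : (f t + t) - (f s + s) ≤ (f a / a + 1) * ((t : ℝ) - s) := by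
  have ha' : (0 : ℝ) < a := ha
  have hs' : (0 : ℝ) < s := ha.trans_le has
  have hst' : (s : ℝ) ≤ t := hst
  have h1 := hf.map_mul_le_map_mul (ha.trans_le has) hst
  have h2 : f s / s ≤ f a / a :=
    hf.antitoneOn_star ⟨ha, a.2.2⟩ ⟨ha.trans_le has, s.2.2⟩ has
  have h3 : f t - f s ≤ f s / s * (t - s) := by
    rw [div_mul_eq_mul_div, le_div_iff₀ hs']
    linarith
  have h4 := mul_le_mul_of_nonneg_right h2 (sub_nonneg.mpr hst')
  linarith

open Set in
/-- On `(a,1]` with `0 < a`, the Stieltjes measure of `t ↦ f t + t` is absolutely continuous. -/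
theorem exists_hat_measure (hf : IsRMMGenerator f) {a : unitInterval} (ha : 0 < a) :
    ∃ p : Measure unitInterval, IsFiniteMeasure p ∧ p ≪ volume ∧
      ∀ x, a ≤ x → p (Ioc a x) = ENNReal.ofReal ((f x + x) - (f a + a)) := by
  -- Clipping to [a,1] extends the function to a globally Lipschitz one on ℝ, whose derivative
  -- serves as the density.
  set c : ℝ → unitInterval := fun t => projIcc 0 1 zero_le_one (max (a : ℝ) t) with hc
  have hcmono : Monotone c := fun s t hst => monotone_projIcc _ (max_le_max le_rfl hst)
  have hca : ∀ t, a ≤ c t := fun t => by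
    have h := monotone_projIcc (zero_le_one (α := ℝ)) (le_max_left (a : ℝ) t)
    rwa [projIcc_val] at h
  have hcx : ∀ x : unitInterval, a ≤ x → c x = x := fun x hx => by
    have hx' : (a : ℝ) ≤ x := hx
    simp only [hc, max_eq_right hx', projIcc_val]
  have hclip : ∀ s t, s ≤ t → (c t : ℝ) - c s ≤ t - s := fun s t hst => by
    simp only [hc, coe_projIcc]
    grind
  set F : ℝ → ℝ := fun t => f (c t) + c t with hF
  have hFmono : Monotone F := fun s t hst => hf.monotone_hat (hcmono hst)
  have hK : 0 ≤ f a / a + 1 := by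
    have := div_nonneg (hf.nonneg a) a.2.1
    linarith
  set K : NNReal := ⟨f a / a + 1, hK⟩ with hKdef
  have hFlip : LipschitzWith K F := by
    refine LipschitzWith.of_le_add_mul K fun x y => ?_
    rcases le_total x y with hxy | hxy
    · exact (hFmono hxy).trans (le_add_of_nonneg_right (by positivity))
    · have h1 := hf.hat_sub_le ha (hca y) (hcmono hxy)
      have h2 := mul_le_mul_of_nonneg_left (hclip y x hxy) hK
      rw [Real.dist_eq, abs_of_nonneg (sub_nonneg.mpr hxy)]
      have h3 : (K : ℝ) = f a / a + 1 := rfl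
      simp only [hF, h3]
      linarith
  have hd0 : ∀ t, 0 ≤ deriv F t := fun t => hFmono.deriv_nonneg
  refine ⟨volume.withDensity fun t : unitInterval => ENNReal.ofReal (deriv F t), ?_,
    withDensity_absolutelyContinuous _ _, fun x hx => ?_⟩
  · refine isFiniteMeasure_withDensity (ne_top_of_le_ne_top (b := (K : ENNReal))
      ENNReal.coe_ne_top ?_)
    calc ∫⁻ t : unitInterval, ENNReal.ofReal (deriv F t) ≤ ∫⁻ _ : unitInterval, (K : ENNReal) := by
          refine lintegral_mono fun t => ?_
          rw [← ENNReal.ofReal_coe_nnreal]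
          exact ENNReal.ofReal_le_ofReal
            ((le_abs_self _).trans (norm_deriv_le_of_lipschitz hFlip))
      _ = K := by simp
  · have hx' : (a : ℝ) ≤ x := hx
    have hsub : Ioc (a : ℝ) x ⊆ unitInterval :=
      fun t ht => ⟨a.2.1.trans ht.1.le, ht.2.trans x.2.2⟩
    have hac : AbsolutelyContinuousOnInterval F a x :=
      (hFlip.lipschitzOnWith).absolutelyContinuousOnInterval
    rw [withDensity_apply _ measurableSet_Ioc,
      unitInterval.measurePreserving_coe.setLIntegral_comp_emb
        unitInterval.measurableEmbedding_coe (fun t => ENNReal.ofReal (deriv F t)),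
      image_subtype_val_Ioc, Measure.restrict_restrict measurableSet_Ioc,
      inter_eq_self_of_subset_left hsub,
      ← ofReal_integral_eq_lintegral_ofReal, ← intervalIntegral.integral_of_le hx',
      hac.integral_deriv_eq_sub]
    · simp only [hF, hcx x hx, hcx a le_rfl]
    · exact (intervalIntegrable_iff_integrableOn_Ioc_of_le hx').mp hac.intervalIntegrable_deriv
    · exact ae_of_all _ hd0

/-- The ratios f(u)/u and g(v)/v decrease, so their product stays at most 1 above and to the right
of (a,b). -/
theorem rmmCopula_eq (hf : IsRMMGenerator f) (hg : IsRMMGenerator g) {a b u v : unitInterval}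
    (ha : 0 < a) (hb : 0 < b) (hab : f a * g b ≤ a * b) (hau : a ≤ u) (hbv : b ≤ v) :
    rmmCopula f g u v = u * v - f u * g v := by
  refine max_eq_right ?_
  have ha' : (0 : ℝ) < a := ha
  have hb' : (0 : ℝ) < b := hb
  have h1 : (f u * a) * (g v * b) ≤ (f a * u) * (g b * v) :=
    mul_le_mul (hf.map_mul_le_map_mul ha hau) (hg.map_mul_le_map_mul hb hbv)
      (mul_nonneg (hg.nonneg v) b.2.1) (mul_nonneg (hf.nonneg a) u.2.1)
  have h2 : (f a * g b) * (u * v : ℝ) ≤ (a * b) * (u * v) :=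
    mul_le_mul_of_nonneg_right hab (mul_nonneg u.2.1 v.2.1)
  have h3 : (f u * g v) * (a * b : ℝ) ≤ (u * v) * (a * b) := by linarith
  have := le_of_mul_le_mul_right h3 (mul_pos ha' hb')
  linarith

end IsRMMGenerator

/-! ### Mass of quadrants -/

open Set in
theorem IsInducedMeasure.real_Ioc_prod_Ioc {μ : Measure (unitInterval × unitInterval)}
    {C : unitInterval → unitInterval → ℝ} (hμ : IsInducedMeasure μ C) {a b x y : unitInterval}
    (hax : a ≤ x) (hby : b ≤ y) :
    μ.real (Ioc a x ×ˢ Ioc b y) = C x y - C a y - C x b + C a b := by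
  have := hμ.isProbabilityMeasure
  have hm : ∀ u v : unitInterval, MeasurableSet (Iic u ×ˢ Iic v) :=
    fun u v => measurableSet_Iic.prod measurableSet_Iic
  have h1 : Ioc a x ×ˢ Ioc b y = (Iic x ×ˢ Iic y) \ (Iic a ×ˢ Iic y ∪ Iic x ×ˢ Iic b) := by
    ext ⟨s, t⟩
    simp only [mem_prod, mem_Ioc, mem_sdiff, mem_Iic, mem_union]
    grind
  have h2 : Iic a ×ˢ Iic y ∪ Iic x ×ˢ Iic b ⊆ Iic x ×ˢ Iic y :=
    union_subset (prod_mono (Iic_subset_Iic.mpr hax) le_rfl)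
      (prod_mono le_rfl (Iic_subset_Iic.mpr hby))
  have h3 : (Iic a ×ˢ Iic y) ∩ (Iic x ×ˢ Iic b) = Iic a ×ˢ Iic b := by
    rw [prod_inter_prod, Iic_inter_Iic, Iic_inter_Iic, inf_eq_left.mpr hax, inf_eq_right.mpr hby]
  have h4 := measureReal_union_add_inter (μ := μ) (s := Iic a ×ˢ Iic y) (hm x b)
  rw [h3, hμ.real_rect, hμ.real_rect, hμ.real_rect] at h4
  rw [h1, measureReal_sdiff h2 ((hm a y).union (hm x b)), hμ.real_rect]
  linarith

open Set in
/-- A fully singular RMM copula puts no mass on a quadrant `(a,1] × (b,1]` on which it is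
given by `u v - f(u) g(v)`. -/
theorem IsInducedMeasure.quadrant_eq_zero {f g : unitInterval → ℝ}
    {μ : Measure (unitInterval × unitInterval)} (hf : IsRMMGenerator f) (hg : IsRMMGenerator g)
    (hμ : IsInducedMeasure μ (rmmCopula f g)) (hsing : μ ⟂ₘ volume) {a b : unitInterval}
    (ha : 0 < a) (hb : 0 < b) (hab : f a * g b ≤ a * b) : μ (Ioi a ×ˢ Ioi b) = 0 := by
  have := hμ.isProbabilityMeasure
  obtain ⟨p, hpfin, hpac, hp⟩ := hf.exists_hat_measure ha
  obtain ⟨q, hqfin, hqac, hq⟩ := hg.exists_hat_measure hb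
  -- Moving the FG term to the left keeps all measures positive; μ is then dominated by the right
  -- side.
  have key : (μ + p.prod q).restrict (Ioi a ×ˢ Ioi b) =
      (p.prod volume + volume.prod q).restrict (Ioi a ×ˢ Ioi b) := by
    refine unitInterval.restrict_quadrant_eq fun x y hx hy => ?_
    have hx' : (a : ℝ) ≤ x := hx
    have hy' : (b : ℝ) ≤ y := hy
    have hP : 0 ≤ (f x + x) - (f a + a) := sub_nonneg.mpr (hf.monotone_hat hx)
    have hQ : 0 ≤ (g y + y) - (g b + b) := sub_nonneg.mpr (hg.monotone_hat hy)
    have hX := sub_nonneg.mpr hx'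
    have hY := sub_nonneg.mpr hy'
    have hreal := hμ.real_Ioc_prod_Ioc hx hy
    rw [hf.rmmCopula_eq hg ha hb hab hx hy, hf.rmmCopula_eq hg ha hb hab le_rfl hy,
      hf.rmmCopula_eq hg ha hb hab hx le_rfl, hf.rmmCopula_eq hg ha hb hab le_rfl le_rfl] at hreal
    rw [Measure.add_apply, Measure.add_apply, Measure.prod_prod, Measure.prod_prod,
      Measure.prod_prod, hp x hx, hq y hy, unitInterval.volume_Ioc, unitInterval.volume_Ioc,
      ← ofReal_measureReal (μ := μ), ← ENNReal.ofReal_mul hP, ← ENNReal.ofReal_mul hP,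
      ← ENNReal.ofReal_mul hX, ← ENNReal.ofReal_add measureReal_nonneg (mul_nonneg hP hQ),
      ← ENNReal.ofReal_add (mul_nonneg hP hY) (mul_nonneg hX hQ), hreal]
    congr 1
    ring
  have hac : μ.restrict (Ioi a ×ˢ Ioi b) ≪ volume := by
    have h1 : μ.restrict (Ioi a ×ˢ Ioi b) ≤ (μ + p.prod q).restrict (Ioi a ×ˢ Ioi b) :=
      Measure.restrict_mono le_rfl (Measure.le_add_right le_rfl)
    rw [key] at h1
    refine (Measure.absolutelyContinuous_of_le (h1.trans Measure.restrict_le_self)).trans ?_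
    rw [Measure.volume_eq_prod]
    exact Measure.AbsolutelyContinuous.add_left
      (hpac.prod Measure.AbsolutelyContinuous.rfl) (Measure.AbsolutelyContinuous.rfl.prod hqac)
  rw [← Measure.restrict_eq_zero]
  exact Measure.eq_zero_of_absolutelyContinuous_of_mutuallySingular hac (hsing.restrict _)

theorem IsRMMGenerator.eq_one_sub_of_mutuallySingular {f g : unitInterval → ℝ}
    {μ : Measure (unitInterval × unitInterval)} (hf : IsRMMGenerator f) (hg : IsRMMGenerator g)
    (hμ : IsInducedMeasure μ (rmmCopula f g)) (hsing : μ ⟂ₘ volume) {a : unitInterval}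
    (ha : 0 < a) (ha1 : a < 1) : f a = 1 - a ∧ g (unitInterval.symm a) = a := by
  set b := unitInterval.symm a with hb
  have ha' : (0 : ℝ) < a := ha
  have ha1' : (a : ℝ) < 1 := ha1
  have hbv : (b : ℝ) = 1 - a := rfl
  have hb0 : 0 < b := by
    rw [← Subtype.coe_lt_coe, hbv]
    simpa using ha1
  have h1 := hf.le_one_sub a
  have h2 : g b ≤ a := by
    have := hg.le_one_sub b
    rw [hbv] at this
    linarith
  have hab : f a * g b ≤ a * b := by
    rw [hbv, mul_comm (a : ℝ)]
    exact mul_le_mul h1 h2 (hg.nonneg b) (by linarith)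
  have h0 := hμ.quadrant_eq_zero hf hg hsing ha hb0 hab
  have hR : Set.Ioi a ×ˢ Set.Ioi b = Set.Ioc a 1 ×ˢ Set.Ioc b 1 := by
    ext ⟨s, t⟩
    simp [unitInterval.le_one']
  have hreal := hμ.real_Ioc_prod_Ioc (unitInterval.le_one' (t := a))
    (unitInterval.le_one' (t := b))
  have e : ∀ {u v}, a ≤ u → b ≤ v → _ :=
    fun {u v} => hf.rmmCopula_eq hg ha hb0 hab (u := u) (v := v)
  rw [← hR, Measure.real, h0, e a.2.2 b.2.2, e le_rfl b.2.2, e a.2.2 le_rfl, e le_rfl le_rfl,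
    hf.map_one, hg.map_one, hbv] at hreal
  simp only [ENNReal.toReal_zero, Set.Icc.coe_one] at hreal
  -- The difference of the two sides is (1 - a - f(a))a + f(a)(a - g(b)), a sum of nonnegative
  -- terms, so each is zero.
  have h3 : (1 - a : ℝ) * a = f a * g b := by linarith
  have h4 : 0 ≤ (1 - a - f a) * a := mul_nonneg (by linarith) ha'.le
  have h5 : 0 ≤ f a * (a - g b) := mul_nonneg (hf.nonneg a) (by linarith)
  have h6 : (1 - a - f a) * a = 0 := by linarith
  have h7 : f a = 1 - a := by
    rcases mul_eq_zero.mp h6 with h | h <;> linarith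
  refine ⟨h7, ?_⟩
  rw [h7] at h3
  exact (mul_left_cancel₀ (by linarith : (1 - a : ℝ) ≠ 0) h3).symm

/-! ### The lower bound W -/

/-- The generator `1 - t` on `(0,1]`, with value `0` at `0`. -/
noncomputable def maxRMMGenerator (t : unitInterval) : ℝ := if t = 0 then 0 else 1 - t

theorem isRMMGenerator_maxRMMGenerator : IsRMMGenerator maxRMMGenerator where
  nonneg t := by
    unfold maxRMMGenerator
    split_ifs
    · exact le_rfl
    · exact sub_nonneg.mpr t.2.2
  map_zero := by simp [maxRMMGenerator]
  map_one := by simp [maxRMMGenerator]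
  monotone_hat s t hst := by
    have hst' : (s : ℝ) ≤ t := hst
    by_cases hs : s = 0
    · by_cases ht : t = 0
      · simp [maxRMMGenerator, hs, ht]
      · simp [maxRMMGenerator, hs, ht]
    · have ht : t ≠ 0 := fun h => hs (le_antisymm (h ▸ hst) s.2.1)
      simp [maxRMMGenerator, hs, ht]
  antitoneOn_star s hs t ht hst := by
    have hs' : (0 : ℝ) < s := hs.1
    have ht' : (0 : ℝ) < t := ht.1
    have hst' : (s : ℝ) ≤ t := hst
    simp only [maxRMMGenerator, hs.1.ne', ht.1.ne', if_false]
    rw [div_le_div_iff₀ ht' hs']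
    linarith

/-- An RMM copula whose generators are both `1 - t` on `(0,1)` is the lower bound `W`. -/
theorem rmmCopula_eq_frechetHoeffdingLower {f g : unitInterval → ℝ} (hf0 : f 0 = 0)
    (hg0 : g 0 = 0) (hf : ∀ t, 0 < t → f t = 1 - t) (hg : ∀ t, 0 < t → g t = 1 - t) :
    rmmCopula f g = frechetHoeffdingLower := by
  funext u v
  unfold rmmCopula frechetHoeffdingLower
  have hu := u.2.2
  have hv := v.2.2
  rcases eq_or_lt_of_le u.2.1 with h | h
  · have h' : u = 0 := Subtype.ext h.symm
    subst h'
    rw [hf0, max_eq_left (by simp), max_eq_left (by simpa using hv)]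
  · rcases eq_or_lt_of_le v.2.1 with k | k
    · have k' : v = 0 := Subtype.ext k.symm
      subst k'
      rw [hg0, max_eq_left (by simp), max_eq_left (by simpa using hu)]
    · rw [hf u h, hg v k]
      congr 1
      ring

open Set in
theorem isFullySingular_frechetHoeffdingLower : IsFullySingular frechetHoeffdingLower := by
  set d : unitInterval → unitInterval × unitInterval := fun t => (t, unitInterval.symm t) with hd
  have hdc : Continuous d := continuous_id.prodMk unitInterval.continuous_symm
  refine ⟨volume.map d, ⟨Measure.isProbabilityMeasure_map hdc.measurable.aemeasurable, ?_⟩, ?_⟩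
  · intro u v
    have hpre : d ⁻¹' (Iic u ×ˢ Iic v) = Icc (unitInterval.symm v) u := by
      ext t
      simp only [hd, mem_preimage, mem_prod, mem_Iic, mem_Icc, unitInterval.symm_le_comm]
      exact and_comm
    rw [measureReal_def, Measure.map_apply hdc.measurable
      (measurableSet_Iic.prod measurableSet_Iic), hpre, unitInterval.volume_Icc,
      ENNReal.toReal_ofReal', max_comm, frechetHoeffdingLower, unitInterval.coe_symm_eq]
    congr 1
    ring
  · have hS : MeasurableSet (range d) := (isCompact_range hdc).measurableSet
    refine ⟨(range d)ᶜ, hS.compl, ?_, ?_⟩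
    · rw [Measure.map_apply hdc.measurable hS.compl, preimage_compl, preimage_range, compl_univ,
        measure_empty]
    · rw [compl_compl, Measure.volume_eq_prod, Measure.measure_prod_null hS]
      refine ae_of_all _ fun t => ?_
      have : Prod.mk t ⁻¹' range d = {unitInterval.symm t} := by
        ext s
        simp [hd, eq_comm]
      simp [this]

theorem mainTheorem4 (C : unitInterval → unitInterval → ℝ) :
    (IsRMMCopula C ∧ IsFullySingular C) ↔ C = frechetHoeffdingLower := by
  constructor
  · rintro ⟨⟨f, g, hf, hg, rfl⟩, μ, hμ, hsing⟩
    refine rmmCopula_eq_frechetHoeffdingLower hf.map_zero hg.map_zero (fun t ht => ?_)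
      (fun t ht => ?_)
    · rcases eq_or_lt_of_le (unitInterval.le_one' (t := t)) with rfl | h
      · simp [hf.map_one]
      · exact (hf.eq_one_sub_of_mutuallySingular hg hμ hsing ht h).1
    · rcases eq_or_lt_of_le (unitInterval.le_one' (t := t)) with rfl | h
      · simp [hg.map_one]
      -- Taking the corner at a = 1 - t makes its second coordinate t.
      · have h' := (hf.eq_one_sub_of_mutuallySingular hg hμ hsing (a := unitInterval.symm t)
          (by rw [← Subtype.coe_lt_coe] at h ⊢; simpa using h)
          (by rw [← Subtype.coe_lt_coe] at ht ⊢; simpa using ht)).2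
        simpa using h'
  · rintro rfl
    have hm := isRMMGenerator_maxRMMGenerator
    have h : ∀ t, 0 < t → maxRMMGenerator t = 1 - t := fun t ht => if_neg ht.ne'
    exact ⟨⟨_, _, hm, hm,
      (rmmCopula_eq_frechetHoeffdingLower hm.map_zero hm.map_zero h h).symm⟩,
      isFullySingular_frechetHoeffdingLower⟩
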